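/- Throughout, $\|\cdot\|$ is the spectral norm (the $\ell_2\to\ell_2$ operator norm) of a real $p\times p$ matrix, $\log$ is the natural logarithm, sequences of random matrices are finite and independent and live on one probability space, and a random matrix $Y$ is called symmetric if $-Y$ has the same distribution as $Y$. Expectations of nonnegative quantities, and both sides of each inequality below, are taken in $[0,\infty]$; whenever the right-hand side is finite, the matrix expectations that occur in it exist. Assume that $p \ge 3$. (i) Let $q \ge 1$ and $r \ge \max\{q, 2\log p\}$, and let $\{W_i\}$ be a finite sequence of independent random positive-semidefinite $p\times p$ matrices. Then $$\Big[\mathbb{E}\,\Big\|\sum_i W_i\Big\|^q\Big]^{1/q} \le \Big[\,\Big\|\sum_i \mathbb{E}\,W_i\Big\|^{1/2} + 2\sqrt{\mathrm{e}\,r}\,\Big(\mathbb{E}\max_i\|W_i\|^q\Big)^{1/(2q)}\Big]^2 .$$ (If $\max_i\|W_i\|$ does not have a finite $q$th moment, then the right-hand side is $+\infty$.) (ii) Let $q \ge 2$ and $r \ge \max\{q, 2\log p\}$, and let $\{Y_i\}$ be a finite sequence of independent, symmetric, random self-adjoint $p\times p$ matrices. Then $$\Big[\mathbb{E}\,\Big\|\sum_i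 Y_i\Big\|^q\Big]^{1/q} \le \sqrt{\mathrm{e}\,r}\,\Big\|\Big(\sum_i \mathbb{E}\,Y_i^2\Big)^{1/2}\Big\| + 2\mathrm{e}\,r\,\Big(\mathbb{E}\max_i\|Y_i\|^q\Big)^{1/q}.$$ (If $\max_i\|Y_i\|$ does not have a finite $q$th moment, then the right-hand side is $+\infty$.) (iii) Let $\{Y_i\}$ be a finite sequence of independent, symmetric, random self-adjoint $p\times p$ matrices. Then $$\Big[\mathbb{E}\,\Big\|\sum_i Y_i\Big\|^2\Big]^{1/2} \le \sqrt{2\mathrm{e}\log p}\,\Big\|\Big(\sum_i \mathbb{E}\,Y_i^2\Big)^{1/2}\Big\| + 4\mathrm{e}\log p\,\Big(\mathbb{E}\max_i\|Y_i\|^2\Big)^{1/2}.$$ -/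

import Mathlib

open MeasureTheory ProbabilityTheory
open scoped ENNReal Matrix.Norms.L2Operator MatrixOrder

/-- The σ-algebra on real matrices generated by the entries. -/
instance instMeasurableSpaceRealMatrix {m n : Type*} : MeasurableSpace (Matrix m n ℝ) :=
  inferInstanceAs (MeasurableSpace (m → n → ℝ))

/-- The σ-algebra generated by the entries is the Borel σ-algebra. -/
instance instBorelSpaceRealMatrix {m n : Type*} [Countable m] [Countable n] :
    BorelSpace (Matrix m n ℝ) :=
  inferInstanceAs (BorelSpace (m → n → ℝ))

/-- A random element `X` of an additive group is *symmetric* (in distribution) if `-X` has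
the same law as `X`. -/
def IsSymmetricRandom {Ω E : Type*} [MeasurableSpace Ω] [MeasurableSpace E] [Neg E]
    (μ : Measure Ω) (X : Ω → E) : Prop :=
  IdentDistrib (fun ω => -X ω) X μ μ

/-! ### The spectral norm of real symmetric matrices -/

section SpectralNorm

variable {n : Type*} [Fintype n] [DecidableEq n]

/-! The engine is a noncommutative Khintchine inequality. For fixed symmetric matrices `A i` and
uniform signs, the trace moment of order `2k` of the signed sum is at most `k ^ k * ‖∑ A i ^ 2‖ ^ k`
times the dimension. It is proved by a discrete integration by parts: flip one sign, telescope the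
difference of powers, and bound the mixed traces (`sum_signs_trace_pow_le`). Taking `k` between `r /
2` and `r` makes the dimension at most `e ^ k`, so passing from trace to norm costs only the factor
`e` in `e * r`.

Positive-semidefinite sums are centred and symmetrized, which costs a factor 2. Khintchine then
produces `‖∑ W i ^ 2‖`, which is at most `max ‖W i‖ * ‖∑ W i‖`. By Cauchy–Schwarz the moment `x`
satisfies `x ≤ a + b * √x`, and solving this gives `x ≤ (√a + b) ^ 2`.

For symmetric summands the signs come for free. Khintchine reduces the claim to `∑ Y i ^ 2`, a
positive-semidefinite sum to which the first result applies at exponent `q / 2`. Signs are averaged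
by finite sums over `ι → ℤˣ`, so no Rademacher variables are adjoined to the probability space. -/

theorem abs_dotProduct_mulVec_le (A : Matrix n n ℝ) (u : n → ℝ) :
    |u ⬝ᵥ (A.mulVec u)| ≤ ‖A‖ * (u ⬝ᵥ u) := by
  have h1 := abs_real_inner_le_norm (WithLp.toLp 2 u) (WithLp.toLp 2 (A.mulVec u))
  have h2 := Matrix.l2_opNorm_mulVec A (WithLp.toLp 2 u)
  have h3 : inner ℝ (WithLp.toLp 2 u) (WithLp.toLp 2 (A.mulVec u)) = u ⬝ᵥ (A.mulVec u) := by
    simp [EuclideanSpace.inner_toLp_toLp, dotProduct_comm]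
  have h4 : ‖WithLp.toLp 2 u‖ ^ 2 = u ⬝ᵥ u := by
    rw [EuclideanSpace.real_norm_sq_eq]
    simp [dotProduct, pow_two]
  rw [h3] at h1
  calc _ ≤ _ := h1
    _ ≤ ‖WithLp.toLp 2 u‖ * (‖A‖ * ‖WithLp.toLp 2 u‖) :=
        mul_le_mul_of_nonneg_left h2 (norm_nonneg _)
    _ = _ := by rw [← h4]; ring

theorem Matrix.IsHermitian.exists_diagonalization {A : Matrix n n ℝ} (hA : A.IsHermitian) :
    ∃ (U : Matrix n n ℝ) (d : n → ℝ), U.transpose * U = 1 ∧ U * U.transpose = 1 ∧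
      (∀ k : ℕ, A ^ k = U * Matrix.diagonal (fun i => d i ^ k) * U.transpose) ∧ ‖A‖ ≤ ‖d‖ := by
  obtain ⟨U, d, h1, h0⟩ : ∃ (U : Matrix n n ℝ) (d : n → ℝ), U.transpose * U = 1 ∧
      A = U * Matrix.diagonal d * U.transpose := by
    refine ⟨hA.eigenvectorUnitary, hA.eigenvalues,
      Matrix.UnitaryGroup.star_mul_self hA.eigenvectorUnitary, ?_⟩
    have h0 := hA.spectral_theorem
    rw [Unitary.conjStarAlgAut_apply] at h0
    exact h0
  have h2 : U * U.transpose = 1 := mul_eq_one_comm.mp h1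
  refine ⟨U, d, h1, h2, fun k => ?_, ?_⟩
  · induction k with
    | zero => simp [h2]
    | succ k ih =>
      rw [pow_succ, ih, h0]
      simp only [Matrix.mul_assoc]
      rw [← Matrix.mul_assoc (Matrix.transpose _) U, h1,
        Matrix.one_mul, ← Matrix.mul_assoc (Matrix.diagonal _) (Matrix.diagonal _),
        Matrix.diagonal_mul_diagonal]
      simp only [pow_succ]
  · have hU : ‖U‖ ≤ 1 := by
      have : ‖U‖ * ‖U‖ ≤ 1 := by
        rw [← Matrix.l2_opNorm_conjTranspose_mul_self,
          Matrix.conjTranspose_eq_transpose_of_trivial,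
          h1, ← Matrix.diagonal_one, Matrix.l2_opNorm_diagonal]
        refine (pi_norm_le_iff_of_nonneg zero_le_one).2 fun i => by simp
      nlinarith [norm_nonneg U]
    have hUt : ‖U.transpose‖ ≤ 1 := by
      rwa [← Matrix.conjTranspose_eq_transpose_of_trivial, Matrix.l2_opNorm_conjTranspose]
    rw [h0]
    calc _ ≤ ‖U‖ * ‖Matrix.diagonal d‖ * ‖U.transpose‖ :=
          (norm_mul_le _ _).trans (mul_le_mul_of_nonneg_right (norm_mul_le _ _) (norm_nonneg _))
      _ ≤ 1 * ‖Matrix.diagonal d‖ * 1 := by gcongr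
      _ = ‖d‖ := by rw [Matrix.l2_opNorm_diagonal]; ring

omit [DecidableEq n] in
theorem exists_norm_le_norm_apply [Nonempty n] (d : n → ℝ) : ∃ i, ‖d‖ ≤ ‖d i‖ := by
  obtain ⟨i, -, hi⟩ := Finset.exists_max_image Finset.univ (fun i => ‖d i‖) Finset.univ_nonempty
  exact ⟨i, (pi_norm_le_iff_of_nonneg (norm_nonneg _)).2 fun j => hi j (Finset.mem_univ _)⟩

theorem Matrix.IsHermitian.norm_pow_le_trace {A : Matrix n n ℝ} (hA : A.IsHermitian) {k : ℕ}
    (hk : k ≠ 0) : ‖A‖ ^ (2 * k) ≤ (A ^ (2 * k)).trace := by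
  obtain ⟨U, d, h1, h2, h, hd⟩ := hA.exists_diagonalization
  have htr : (A ^ (2 * k)).trace = ∑ i, d i ^ (2 * k) := by
    rw [h, Matrix.trace_mul_comm, ← Matrix.mul_assoc, h1, Matrix.one_mul, Matrix.trace_diagonal]
  rw [htr]
  refine (pow_le_pow_left₀ (norm_nonneg _) hd _).trans ?_
  have hnn : ∀ i, 0 ≤ d i ^ (2 * k) := fun i => (even_two_mul k).pow_nonneg _
  -- In dimension zero the trace vanishes, and `k ≠ 0` makes the left side vanish too.
  rcases isEmpty_or_nonempty n with hn | hn
  · simp [Pi.norm_def, hk]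
  · obtain ⟨i, hi⟩ := exists_norm_le_norm_apply d
    calc ‖d‖ ^ (2 * k) ≤ ‖d i‖ ^ (2 * k) := by gcongr
      _ = d i ^ (2 * k) := by rw [Real.norm_eq_abs, (even_two_mul k).pow_abs]
      _ ≤ _ := Finset.single_le_sum (fun j _ => hnn j) (Finset.mem_univ i)

theorem Matrix.IsHermitian.exists_unit_norm_le [Nonempty n] {A : Matrix n n ℝ}
    (hA : A.IsHermitian) :
    ∃ u : n → ℝ, u ⬝ᵥ u = 1 ∧ ‖A‖ ≤ |u ⬝ᵥ (A.mulVec u)| := by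
  obtain ⟨U, d, h1, h2, h, hd⟩ := hA.exists_diagonalization
  obtain ⟨i, hi⟩ := exists_norm_le_norm_apply d
  have hquad : ∀ B : Matrix n n ℝ, (U.transpose * B * U) i i =
      (fun j => U j i) ⬝ᵥ B.mulVec (fun j => U j i) := by
    intro B
    rw [Matrix.mul_assoc, Matrix.mul_apply']
    rfl
  have hD : U.transpose * A * U = Matrix.diagonal d := by
    have := h 1
    simp only [pow_one] at this
    calc U.transpose * A * U = (U.transpose * U) * Matrix.diagonal d * (U.transpose * U) := by
          rw [this]; simp only [Matrix.mul_assoc]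
      _ = _ := by rw [h1, Matrix.one_mul, Matrix.mul_one]
  refine ⟨fun j => U j i, ?_, ?_⟩
  · have := hquad 1
    rw [Matrix.mul_one, h1, Matrix.one_mulVec] at this
    simpa using this.symm
  · rw [← hquad A, hD, Matrix.diagonal_apply_eq]
    exact hd.trans hi

theorem Matrix.PosSemidef.exists_eq_transpose_mul_self {B : Matrix n n ℝ} (hB : B.PosSemidef) :
    ∃ C : Matrix n n ℝ, B = C.transpose * C := by
  have h0 : 0 ≤ B := Matrix.nonneg_iff_posSemidef.mpr hB
  refine ⟨CFC.sqrt B, ?_⟩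
  have h1 : (CFC.sqrt B).transpose = CFC.sqrt B := (IsSelfAdjoint.of_nonneg (CFC.sqrt_nonneg B))
  rw [h1, CFC.sqrt_mul_sqrt_self B h0]

/-- With `B = Cᵀ C`, both traces become sums over the rows of `C`, and each quadratic form of `S` is
controlled by its norm. -/
theorem Matrix.PosSemidef.trace_mul_le (S : Matrix n n ℝ) {B : Matrix n n ℝ} (hB : B.PosSemidef) :
    (S * B).trace ≤ ‖S‖ * B.trace := by
  obtain ⟨C, rfl⟩ := hB.exists_eq_transpose_mul_self
  have key : ∀ T : Matrix n n ℝ, (T * (C.transpose * C)).trace =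
      ∑ i, C i ⬝ᵥ T.mulVec (C i) := by
    intro T
    rw [← Matrix.mul_assoc, Matrix.trace_mul_comm]
    simp only [Matrix.trace, Matrix.diag]
    refine Finset.sum_congr rfl fun i _ => ?_
    rw [Matrix.mul_apply']
    rfl
  have k1 := key 1
  rw [Matrix.one_mul] at k1
  rw [key, k1, Finset.mul_sum]
  refine Finset.sum_le_sum fun i _ => ?_
  rw [Matrix.one_mulVec]
  exact (le_abs_self _).trans (abs_dotProduct_mulVec_le _ _)

/-- This is `W ^ 2 ≤ ‖W‖ • W` read on quadratic forms. With `W = Cᵀ C` and `v = C u`, the form of `W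
^ 2` at `u` is that of `C Cᵀ` at `v`, and `‖C Cᵀ‖ = ‖W‖`. -/
theorem norm_sum_sq_le_of_posSemidef [Nonempty n] {ι : Type*} [Fintype ι] (W : ι → Matrix n n ℝ)
    (hW : ∀ i, (W i).PosSemidef) {M : ℝ} (hM0 : 0 ≤ M) (hM : ∀ i, ‖W i‖ ≤ M) :
    ‖∑ i, W i ^ 2‖ ≤ M * ‖∑ i, W i‖ := by
  have hH : (∑ i, W i ^ 2).IsHermitian :=
    isSelfAdjoint_sum _ fun i _ => (hW i).1.pow 2
  obtain ⟨u, hu, hle⟩ := hH.exists_unit_norm_le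
  have hi : ∀ i, |u ⬝ᵥ (W i ^ 2).mulVec u| ≤ M * (u ⬝ᵥ (W i).mulVec u) := by
    intro i
    obtain ⟨C, hC⟩ := (hW i).exists_eq_transpose_mul_self
    have e1 : u ⬝ᵥ (W i).mulVec u = C.mulVec u ⬝ᵥ C.mulVec u := by
      rw [hC, ← Matrix.mulVec_mulVec, Matrix.dotProduct_mulVec, Matrix.vecMul_transpose]
    have e2 : u ⬝ᵥ (W i ^ 2).mulVec u = C.mulVec u ⬝ᵥ (C * C.transpose).mulVec (C.mulVec u) := by
      rw [hC, pow_two, Matrix.mul_assoc, ← Matrix.mulVec_mulVec, Matrix.dotProduct_mulVec,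
        Matrix.vecMul_transpose, Matrix.mulVec_mulVec, Matrix.mul_assoc]
    have e3 : ‖C * C.transpose‖ = ‖W i‖ := by
      have := Matrix.l2_opNorm_conjTranspose_mul_self C.conjTranspose
      rw [Matrix.conjTranspose_conjTranspose, Matrix.l2_opNorm_conjTranspose,
        ← Matrix.l2_opNorm_conjTranspose_mul_self,
        Matrix.conjTranspose_eq_transpose_of_trivial] at this
      rw [this, hC]
    rw [e1, e2]
    refine (abs_dotProduct_mulVec_le _ _).trans ?_
    rw [e3]
    refine mul_le_mul_of_nonneg_right (hM i) ?_
    exact Finset.sum_nonneg fun j _ => mul_self_nonneg _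
  refine hle.trans ?_
  rw [Matrix.sum_mulVec, dotProduct_sum]
  calc |∑ i, u ⬝ᵥ (W i ^ 2).mulVec u| ≤ ∑ i, |u ⬝ᵥ (W i ^ 2).mulVec u| :=
        Finset.abs_sum_le_sum_abs _ _
    _ ≤ ∑ i, M * (u ⬝ᵥ (W i).mulVec u) := Finset.sum_le_sum fun i _ => hi i
    _ = M * (u ⬝ᵥ (∑ i, W i).mulVec u) := by
        rw [← Finset.mul_sum, Matrix.sum_mulVec, dotProduct_sum]
    _ ≤ M * ‖∑ i, W i‖ := by
        refine mul_le_mul_of_nonneg_left ?_ hM0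
        have := (le_abs_self _).trans (abs_dotProduct_mulVec_le (∑ i, W i) u)
        rwa [hu, mul_one] at this

end SpectralNorm

/-! ### The noncommutative Khintchine inequality -/

section Khintchine

theorem pow_mul_pow_add_le (a b : ℝ) {j l m : ℕ} (hm : Even m) (hjl : j + l = m) :
    a ^ j * b ^ l + a ^ l * b ^ j ≤ a ^ m + b ^ m := by
  rw [← hm.pow_abs a, ← hm.pow_abs b]
  have h1 : a ^ j * b ^ l + a ^ l * b ^ j ≤ |a| ^ j * |b| ^ l + |a| ^ l * |b| ^ j := by
    simp only [← abs_pow, ← abs_mul]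
    exact add_le_add (le_abs_self _) (le_abs_self _)
  refine h1.trans ?_
  have hs : 0 ≤ (|a| ^ j - |b| ^ j) * (|a| ^ l - |b| ^ l) := by
    rcases le_total |a| |b| with h | h
    · exact mul_nonneg_of_nonpos_of_nonpos
        (sub_nonpos.2 (pow_le_pow_left₀ (abs_nonneg _) h _))
        (sub_nonpos.2 (pow_le_pow_left₀ (abs_nonneg _) h _))
    · exact mul_nonneg
        (sub_nonneg.2 (pow_le_pow_left₀ (abs_nonneg _) h _))
        (sub_nonneg.2 (pow_le_pow_left₀ (abs_nonneg _) h _))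
  rw [← hjl, pow_add, pow_add]
  linarith

/-- The terms `j` and `m - j` are paired, so that each pair is at most `a ^ m + b ^ m`. -/
theorem two_mul_sum_pow_mul_pow_le (a b : ℝ) {m : ℕ} (hm : Even m) :
    2 * ∑ j ∈ Finset.range (m + 1), a ^ j * b ^ (m - j) ≤ (m + 1) * (a ^ m + b ^ m) := by
  have h := Finset.sum_range_reflect (fun j => a ^ j * b ^ (m - j)) (m + 1)
  rw [two_mul]
  nth_rewrite 2 [← h]
  rw [← Finset.sum_add_distrib]
  calc _ ≤ ∑ j ∈ Finset.range (m + 1), (a ^ m + b ^ m) := by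
        refine Finset.sum_le_sum fun j hj => ?_
        have hj' : j ≤ m := Nat.lt_succ_iff.mp (Finset.mem_range.mp hj)
        have e1 : m + 1 - 1 - j = m - j := by omega
        have e2 : m - (m - j) = j := by omega
        rw [e1, e2]
        exact pow_mul_pow_add_le a b hm (by omega)
    _ = _ := by simp [mul_add]

variable {n : Type*} [Fintype n] [DecidableEq n]

/-- In eigenbases of `X` and `Y` the mixed trace is a combination of scalar monomials. The weights
are squares that do not depend on the exponents, so scalar inequalities transfer to traces. -/
theorem exists_trace_mul_pow_mul_pow_eq {X Y : Matrix n n ℝ} (hX : X.IsHermitian)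
    (hY : Y.IsHermitian) {A : Matrix n n ℝ} (hA : A.IsHermitian) :
    ∃ (G : n → n → ℝ) (d e : n → ℝ), ∀ j l : ℕ,
      (A * X ^ j * A * Y ^ l).trace = ∑ a, ∑ b, G a b ^ 2 * (d a ^ j * e b ^ l) := by
  obtain ⟨U, d, -, -, hU, -⟩ := hX.exists_diagonalization
  obtain ⟨V, e, -, -, hV, -⟩ := hY.exists_diagonalization
  refine ⟨fun a b => (U.transpose * A * V) a b, d, e, fun j l => ?_⟩
  have hAt : A.transpose = A := hA
  have e1 : (A * X ^ j * A * Y ^ l).trace =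
      ((U.transpose * A * V).transpose * (Matrix.diagonal (fun i => d i ^ j) *
        (U.transpose * A * V * Matrix.diagonal (fun i => e i ^ l)))).trace := by
    rw [hU, hV]
    rw [← Matrix.mul_assoc _ _ V.transpose, Matrix.trace_mul_comm]
    simp only [Matrix.transpose_mul, hAt, Matrix.transpose_transpose, Matrix.mul_assoc]
  rw [e1, Matrix.trace, Finset.sum_comm]
  refine Finset.sum_congr rfl fun b _ => ?_
  rw [Matrix.diag_apply, Matrix.mul_apply]
  refine Finset.sum_congr rfl fun a _ => ?_
  rw [Matrix.transpose_apply, Matrix.diagonal_mul, Matrix.mul_diagonal]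
  ring

theorem two_mul_sum_trace_le {X Y : Matrix n n ℝ} (hX : X.IsHermitian)
    (hY : Y.IsHermitian) {A : Matrix n n ℝ} (hA : A.IsHermitian) {m : ℕ} (hm : Even m) :
    2 * ∑ j ∈ Finset.range (m + 1), (A * X ^ j * A * Y ^ (m - j)).trace ≤
      (m + 1) * ((A ^ 2 * X ^ m).trace + (A ^ 2 * Y ^ m).trace) := by
  obtain ⟨G, d, e, h⟩ := exists_trace_mul_pow_mul_pow_eq hX hY hA
  have h1 : (A ^ 2 * X ^ m).trace = (A * X ^ m * A * Y ^ 0).trace := by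
    rw [pow_zero, Matrix.mul_one, Matrix.mul_assoc, Matrix.trace_mul_comm A, Matrix.mul_assoc,
      Matrix.trace_mul_comm, pow_two]
  have h2 : (A ^ 2 * Y ^ m).trace = (A * X ^ 0 * A * Y ^ m).trace := by
    rw [pow_zero, Matrix.mul_one, pow_two]
  rw [h1, h2]
  simp only [h]
  rw [Finset.sum_comm, ← Finset.sum_add_distrib, Finset.mul_sum, Finset.mul_sum]
  refine Finset.sum_le_sum fun a _ => ?_
  rw [Finset.sum_comm, ← Finset.sum_add_distrib, Finset.mul_sum, Finset.mul_sum]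
  refine Finset.sum_le_sum fun b _ => ?_
  rw [← Finset.mul_sum, pow_zero, pow_zero, mul_one, one_mul]
  have := mul_le_mul_of_nonneg_left (two_mul_sum_pow_mul_pow_le (d a) (e b) hm)
    (sq_nonneg (G a b))
  linarith

variable {ι : Type*} [Fintype ι] [DecidableEq ι]

/-- The signed sum `∑ i, ε i • A i`. -/
def signedSum {E : Type*} [AddCommGroup E] (A : ι → E) (ε : ι → ℤˣ) : E := ∑ i, ε i • A i

omit [Fintype n] [DecidableEq n] [DecidableEq ι] in
theorem signedSum_isHermitian {A : ι → Matrix n n ℝ} (hA : ∀ i, (A i).IsHermitian) (ε : ι → ℤˣ) :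
    (signedSum A ε).IsHermitian := by
  refine isSelfAdjoint_sum _ fun i _ => ?_
  rcases Int.units_eq_one_or (ε i) with h | h
  · rw [h, one_smul]; exact hA i
  · rw [h, Units.neg_smul, one_smul]; exact (hA i).neg

/-- Flipping the sign at `i`. -/
def flipSign (i : ι) : Equiv.Perm (ι → ℤˣ) := Equiv.mulRight (Pi.mulSingle i (-1))

theorem signedSum_flipSign {E : Type*} [AddCommGroup E] (A : ι → E) (ε : ι → ℤˣ) (i : ι) :
    signedSum A ε - signedSum A (flipSign i ε) = (2 : ℤ) • ε i • A i := by
  unfold signedSum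
  rw [← Finset.sum_sub_distrib, Finset.sum_eq_single i]
  · simp [flipSign, two_smul]
  · intro j _ hj
    simp [flipSign, hj]
  · simp

/-- One factor `ε i • A i` is split off. Flipping `ε i` turns the sum into half a difference of
powers of `X` and `Y`, where `X - Y = 2 ε i A i`. Telescoping gives the mixed traces of
`two_mul_sum_trace_le`, and the two signs `ε i` cancel. -/
theorem sum_signs_trace_pow_le {A : ι → Matrix n n ℝ} (hA : ∀ i, (A i).IsHermitian) {m : ℕ}
    (hm : Even m) :
    ∑ ε : ι → ℤˣ, (signedSum A ε ^ (m + 2)).trace ≤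
      (m + 1) * ∑ ε : ι → ℤˣ, ((∑ i, A i ^ 2) * signedSum A ε ^ m).trace := by
  have hstep : ∀ i, ∑ ε : ι → ℤˣ, ((ε i • A i) * signedSum A ε ^ (m + 1)).trace ≤
      (m + 1) * ∑ ε : ι → ℤˣ, (A i ^ 2 * signedSum A ε ^ m).trace := by
    intro i
    have hflip : ∑ ε : ι → ℤˣ, ((ε i • A i) * signedSum A (flipSign i ε) ^ (m + 1)).trace =
        -∑ ε : ι → ℤˣ, ((ε i • A i) * signedSum A ε ^ (m + 1)).trace := by
      rw [← Equiv.sum_comp (flipSign i) (fun ε => ((ε i • A i) * signedSum A ε ^ (m + 1)).trace),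
        ← Finset.sum_neg_distrib]
      refine Finset.sum_congr rfl fun ε _ => ?_
      have : (flipSign i ε) i = -ε i := by simp [flipSign]
      rw [this, Units.neg_smul, Matrix.neg_mul, Matrix.trace_neg, neg_neg]
    have hflip2 : ∑ ε : ι → ℤˣ, (A i ^ 2 * signedSum A (flipSign i ε) ^ m).trace =
        ∑ ε : ι → ℤˣ, (A i ^ 2 * signedSum A ε ^ m).trace :=
      Equiv.sum_comp (flipSign i) (fun ε => (A i ^ 2 * signedSum A ε ^ m).trace)
    have hdiff : ∀ ε : ι → ℤˣ, ((ε i • A i) * signedSum A ε ^ (m + 1)).trace -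
        ((ε i • A i) * signedSum A (flipSign i ε) ^ (m + 1)).trace ≤
        (m + 1) * ((A i ^ 2 * signedSum A ε ^ m).trace +
          (A i ^ 2 * signedSum A (flipSign i ε) ^ m).trace) := by
      intro ε
      refine le_trans (le_of_eq ?_) (two_mul_sum_trace_le (signedSum_isHermitian hA ε)
        (signedSum_isHermitian hA (flipSign i ε)) (hA i) hm)
      have hs := signedSum_flipSign A ε i
      set X := signedSum A ε
      set Y := signedSum A (flipSign i ε)
      have htel : X ^ (m + 1) - Y ^ (m + 1) =
          ∑ j ∈ Finset.range (m + 1), X ^ j * (X - Y) * Y ^ (m - j) := by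
        have := Finset.sum_range_sub (fun j => X ^ j * Y ^ (m + 1 - j)) (m + 1)
        simp only [pow_zero, one_mul, Nat.sub_self, mul_one, Nat.sub_zero] at this
        rw [← this]
        refine Finset.sum_congr rfl fun j hj => ?_
        have hj' : j ≤ m := Nat.lt_succ_iff.mp (Finset.mem_range.mp hj)
        rw [show m + 1 - (j + 1) = m - j by omega, show m + 1 - j = m - j + 1 by omega,
          pow_succ, pow_succ' Y]
        noncomm_ring
      rw [← Matrix.trace_sub, ← Matrix.mul_sub, htel, hs, Finset.mul_sum, Matrix.trace_sum,
        Finset.mul_sum]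
      refine Finset.sum_congr rfl fun j _ => ?_
      rcases Int.units_eq_one_or (ε i) with h | h <;>
      simp [h, Matrix.mul_assoc, two_mul, two_smul, Matrix.mul_add, Matrix.add_mul]
    have := Finset.sum_le_sum fun ε (_ : ε ∈ Finset.univ) => hdiff ε
    rw [Finset.sum_sub_distrib, hflip, ← Finset.mul_sum, Finset.sum_add_distrib, hflip2] at this
    linarith
  calc ∑ ε : ι → ℤˣ, (signedSum A ε ^ (m + 2)).trace
      = ∑ i, ∑ ε : ι → ℤˣ, ((ε i • A i) * signedSum A ε ^ (m + 1)).trace := by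
        rw [Finset.sum_comm]
        refine Finset.sum_congr rfl fun ε _ => ?_
        rw [← Matrix.trace_sum, ← Finset.sum_mul, show m + 2 = m + 1 + 1 from rfl, pow_succ' _ (m + 1)]
        rfl
    _ ≤ ∑ i, (m + 1) * ∑ ε : ι → ℤˣ, (A i ^ 2 * signedSum A ε ^ m).trace :=
        Finset.sum_le_sum fun i _ => hstep i
    _ = _ := by
        rw [← Finset.mul_sum, Finset.sum_comm]
        simp only [Finset.sum_mul, Matrix.trace_sum]

theorem sum_signs_trace_even_pow_le {A : ι → Matrix n n ℝ} (hA : ∀ i, (A i).IsHermitian) (k : ℕ) :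
    ∑ ε : ι → ℤˣ, (signedSum A ε ^ (2 * k)).trace ≤
      (k : ℝ) ^ k * ‖∑ i, A i ^ 2‖ ^ k * (2 ^ Fintype.card ι * Fintype.card n) := by
  induction k with
  | zero => simp
  | succ k ih =>
    have h1 := sum_signs_trace_pow_le hA (even_two_mul k)
    have h2 : ∀ ε : ι → ℤˣ, ((∑ i, A i ^ 2) * signedSum A ε ^ (2 * k)).trace ≤
        ‖∑ i, A i ^ 2‖ * (signedSum A ε ^ (2 * k)).trace := by
      intro ε
      refine Matrix.PosSemidef.trace_mul_le _ ?_
      have hH := (signedSum_isHermitian hA ε).pow k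
      have := Matrix.posSemidef_conjTranspose_mul_self (signedSum A ε ^ k)
      rwa [hH.eq, ← pow_add, ← two_mul] at this
    have h3 := Finset.sum_le_sum fun ε (_ : ε ∈ Finset.univ) => h2 ε
    rw [← Finset.mul_sum] at h3
    -- The recursion yields the product of the odd numbers below `2k`. Bernoulli's inequality `(1 +
    -- 1/k) ^ k ≥ 2` keeps it under `k ^ k`.
    have hk : (2 * k + 1 : ℝ) * k ^ k ≤ (k + 1 : ℝ) ^ (k + 1) := by
      rcases Nat.eq_zero_or_pos k with rfl | hk
      · norm_num
      have hk' : (0 : ℝ) < k := by exact_mod_cast hk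
      have hb : 2 * (k : ℝ) ^ k ≤ (k + 1 : ℝ) ^ k := by
        have h0 : 0 < 1 / (k : ℝ) := by positivity
        have := one_add_mul_le_pow (a := (1 / k : ℝ)) (by linarith) k
        calc 2 * (k : ℝ) ^ k = (1 + k * (1 / k : ℝ)) * (k : ℝ) ^ k := by field_simp; norm_num
          _ ≤ (1 + 1 / k : ℝ) ^ k * (k : ℝ) ^ k := by gcongr
          _ = (k + 1 : ℝ) ^ k := by rw [← mul_pow]; congr 1; field_simp
      calc (2 * k + 1 : ℝ) * k ^ k ≤ (k + 1) * (2 * (k : ℝ) ^ k) := by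
            nlinarith [pow_pos hk' k]
        _ ≤ (k + 1) * (k + 1 : ℝ) ^ k := by gcongr
        _ = _ := by ring
    calc _ ≤ _ := h1
      _ ≤ (2 * k + 1 : ℝ) * (‖∑ i, A i ^ 2‖ *
          ((k : ℝ) ^ k * ‖∑ i, A i ^ 2‖ ^ k * (2 ^ Fintype.card ι * Fintype.card n))) := by
        push_cast
        gcongr
        exact h3.trans (mul_le_mul_of_nonneg_left ih (norm_nonneg _))
      _ = ((2 * k + 1 : ℝ) * k ^ k) *
          (‖∑ i, A i ^ 2‖ ^ (k + 1) * (2 ^ Fintype.card ι * Fintype.card n)) := by ring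
      _ ≤ ((k + 1 : ℝ) ^ (k + 1)) *
          (‖∑ i, A i ^ 2‖ ^ (k + 1) * (2 ^ Fintype.card ι * Fintype.card n)) :=
        mul_le_mul_of_nonneg_right hk (by positivity)
      _ = _ := by
        push_cast
        ring

theorem sum_rpow_le_of_sum_even_pow_le {α : Type*} [Fintype α] [Nonempty α] {x : α → ℝ}
    (hx : ∀ a, 0 ≤ x a) {q B : ℝ} {k : ℕ} (hq : 0 < q) (hqk : q ≤ 2 * k) (hB : 0 ≤ B)
    (h : ∑ a, x a ^ (2 * k) ≤ Fintype.card α * B ^ k) :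
    ∑ a, x a ^ q ≤ Fintype.card α * B ^ (q / 2) := by
  obtain ⟨N, hN⟩ : ∃ N : ℝ, N = Fintype.card α := ⟨_, rfl⟩
  have hNpos : 0 < N := by rw [hN]; exact_mod_cast Fintype.card_pos
  rw [← hN] at h ⊢
  -- Jensen's exponent from order `q` up to order `2k`.
  set s : ℝ := 2 * k / q with hs
  have hs1 : 1 ≤ s := by
    rw [hs, le_div_iff₀ hq]
    linarith
  have hxq : ∀ a, 0 ≤ x a ^ q := fun a => Real.rpow_nonneg (hx a) _
  have hmean := Real.rpow_arith_mean_le_arith_mean_rpow (Finset.univ : Finset α)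
    (fun _ => N⁻¹) (fun a => x a ^ q) (fun _ _ => by positivity)
    (by rw [Finset.sum_const, nsmul_eq_mul, Finset.card_univ, ← hN, mul_inv_cancel₀ hNpos.ne'])
    (fun a _ => hxq a) hs1
  rw [← Finset.mul_sum, ← Finset.mul_sum] at hmean
  have hpow : ∀ a, (x a ^ q) ^ s = x a ^ (2 * k) := by
    intro a
    rw [← Real.rpow_mul (hx a), ← Real.rpow_natCast]
    congr 1
    rw [hs]
    push_cast
    field_simp
  simp only [hpow] at hmean
  have hfin : (N⁻¹ * ∑ a, x a ^ q) ^ s ≤ (B ^ (q / 2)) ^ s := by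
    refine hmean.trans ?_
    rw [← Real.rpow_mul hB, show q / 2 * s = k by rw [hs]; field_simp, Real.rpow_natCast]
    calc _ ≤ N⁻¹ * (N * B ^ k) := by gcongr
      _ = _ := by field_simp
  rw [Real.rpow_le_rpow_iff (mul_nonneg (inv_nonneg.2 hNpos.le) (Finset.sum_nonneg fun a _ => hxq a))
    (by positivity) (by linarith)] at hfin
  rwa [inv_mul_le_iff₀ hNpos] at hfin

theorem sum_signs_norm_rpow_le [Nonempty n] {A : ι → Matrix n n ℝ} (hA : ∀ i, (A i).IsHermitian)
    {q r : ℝ} (hq : 0 < q) (hqr : q ≤ r) (hr : 2 ≤ r) (hn : 2 * Real.log (Fintype.card n) ≤ r) :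
    ∑ ε : ι → ℤˣ, ‖signedSum A ε‖ ^ q ≤
      Fintype.card (ι → ℤˣ) * (Real.exp 1 * r * ‖∑ i, A i ^ 2‖) ^ (q / 2) := by
  -- The lower bound covers both `q ≤ 2k` and `log (card n) ≤ k`. The upper bound holds because `r ≥
  -- 2` absorbs the rounding.
  obtain ⟨k, hk1, hk2⟩ : ∃ k : ℕ, r / 2 ≤ k ∧ (k : ℝ) ≤ r :=
    ⟨⌈r / 2⌉₊, Nat.le_ceil _, by linarith [Nat.ceil_lt_add_one (a := r / 2) (by linarith)]⟩
  have hk0 : k ≠ 0 := by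
    rintro rfl
    norm_num at hk1
    linarith
  refine sum_rpow_le_of_sum_even_pow_le (k := k) (fun ε => norm_nonneg _) hq (by linarith)
    (by positivity) ?_
  have hp : (Fintype.card n : ℝ) ≤ Real.exp 1 ^ k := by
    have hpos : (0 : ℝ) < Fintype.card n := by exact_mod_cast Fintype.card_pos
    rw [← Real.exp_nat_mul, mul_one, ← Real.log_le_iff_le_exp hpos]
    linarith
  have hcard : (Fintype.card (ι → ℤˣ) : ℝ) = 2 ^ Fintype.card ι := by simp
  calc ∑ ε : ι → ℤˣ, ‖signedSum A ε‖ ^ (2 * k)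
      ≤ ∑ ε : ι → ℤˣ, (signedSum A ε ^ (2 * k)).trace :=
        Finset.sum_le_sum fun ε _ => (signedSum_isHermitian hA ε).norm_pow_le_trace hk0
    _ ≤ (k : ℝ) ^ k * ‖∑ i, A i ^ 2‖ ^ k * (2 ^ Fintype.card ι * Fintype.card n) :=
        sum_signs_trace_even_pow_le hA k
    _ ≤ r ^ k * ‖∑ i, A i ^ 2‖ ^ k * (2 ^ Fintype.card ι * Real.exp 1 ^ k) := by gcongr
    _ = _ := by rw [hcard, mul_pow, mul_pow]; ring

end Khintchine

/-! ### Symmetrization -/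

section Symmetrization

variable {Ω : Type*} [MeasurableSpace Ω] {μ : Measure Ω} [IsProbabilityMeasure μ]
  {ι : Type*} [Fintype ι] [DecidableEq ι]
  {E : Type*} [NormedAddCommGroup E] [MeasurableSpace E] [BorelSpace E]
  [SecondCountableTopology E]

omit [SecondCountableTopology E] in
theorem measurable_units_int_smul (e : ℤˣ) : Measurable fun x : E => e • x := by
  rcases Int.units_eq_one_or e with h | h
  · simpa [h] using measurable_id'
  · simpa [h, Units.neg_smul] using measurable_neg

omit [DecidableEq ι] in
theorem measurable_signedSum (ε : ι → ℤˣ) : Measurable fun x : ι → E => signedSum x ε :=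
  Finset.measurable_fun_sum _ fun i _ =>
    (measurable_units_int_smul (ε i)).comp (measurable_pi_apply i)

omit [DecidableEq ι] in
-- By independence the joint law is a product, and a sign change preserves every factor.
theorem lintegral_signedSum_eq_of_symmetric {Y : ι → Ω → E} (hY : ∀ i, Measurable (Y i))
    (hind : iIndepFun Y μ) (hsymm : ∀ i, IsSymmetricRandom μ (Y i)) {f : E → ℝ≥0∞}
    (hf : Measurable f) (ε : ι → ℤˣ) :
    ∫⁻ ω, f (signedSum (fun i => Y i ω) ε) ∂μ = ∫⁻ ω, f (∑ i, Y i ω) ∂μ := by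
  have hlaw := (iIndepFun_iff_map_fun_eq_pi_map fun i => (hY i).aemeasurable).1 hind
  have hYm : Measurable fun ω i => Y i ω := measurable_pi_lambda _ hY
  have : ∀ i, IsProbabilityMeasure (μ.map (Y i)) := fun i =>
    Measure.isProbabilityMeasure_map (hY i).aemeasurable
  have hflip : MeasurePreserving (fun (x : ι → E) i => ε i • x i)
      (Measure.pi fun i => μ.map (Y i)) (Measure.pi fun i => μ.map (Y i)) := by
    refine measurePreserving_pi _ _ (f := fun i x => ε i • x)
      fun i => ⟨measurable_units_int_smul (ε i), ?_⟩
    rcases Int.units_eq_one_or (ε i) with h | h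
    · simp only [h, one_smul]
      exact Measure.map_id
    · simp only [h, Units.neg_smul, one_smul]
      rw [Measure.map_map measurable_neg (hY i)]
      exact (hsymm i).map_eq
  have hg : Measurable fun x : ι → E => f (∑ i, x i) :=
    hf.comp (Finset.measurable_fun_sum _ fun i _ => measurable_pi_apply i)
  have h1 := lintegral_map (μ := μ) (hf.comp (measurable_signedSum ε)) hYm
  have h2 := lintegral_map (μ := μ) hg hYm
  simp only [Function.comp_def] at h1
  rw [← h1, ← h2, hlaw]
  exact hflip.lintegral_comp hg

omit [DecidableEq ι] in
theorem lintegral_prod_sub_eq_signedSum {W : ι → Ω → E} (hW : ∀ i, Measurable (W i))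
    (hind : iIndepFun W μ) {f : E → ℝ≥0∞} (hf : Measurable f) (ε : ι → ℤˣ) :
    ∫⁻ z, f (∑ i, (W i z.1 - W i z.2)) ∂(μ.prod μ) =
      ∫⁻ z, f (signedSum (fun i => W i z.1 - W i z.2) ε) ∂(μ.prod μ) := by
  have hlaw := (iIndepFun_iff_map_fun_eq_pi_map fun i => (hW i).aemeasurable).1 hind
  have hWm : Measurable fun ω i => W i ω := measurable_pi_lambda _ hW
  set ν : ι → Measure E := fun i => μ.map (W i) with hν
  have : ∀ i, IsProbabilityMeasure (ν i) := fun i =>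
    Measure.isProbabilityMeasure_map (hW i).aemeasurable
  have hmap : MeasurePreserving (fun z : Ω × Ω => ((fun i => W i z.1, fun i => W i z.2) :
      (ι → E) × (ι → E))) (μ.prod μ) ((Measure.pi ν).prod (Measure.pi ν)) :=
    MeasurePreserving.prod ⟨hWm, hlaw⟩ ⟨hWm, hlaw⟩
  -- Regrouping two independent copies as a family of independent pairs makes the differences
  -- independent. Swapping a pair shows that each is symmetric.
  have harr := measurePreserving_arrowProdEquivProdArrow E E ι ν ν
  have htrans : ∀ g : (ι → E) → ℝ≥0∞, Measurable g →
      ∫⁻ z, g (fun i => W i z.1 - W i z.2) ∂(μ.prod μ) =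
        ∫⁻ x : ι → E × E, g (fun i => (x i).1 - (x i).2) ∂(Measure.pi fun i => (ν i).prod (ν i)) := by
    intro g hg
    have hg' : Measurable fun y : (ι → E) × (ι → E) => g (fun i => y.1 i - y.2 i) := by
      refine hg.comp (measurable_pi_lambda _ fun i => ?_)
      exact ((measurable_pi_apply i).comp measurable_fst).sub
        ((measurable_pi_apply i).comp measurable_snd)
    have h1 := hmap.lintegral_comp hg'
    have h2 := harr.lintegral_comp hg'
    exact h1.trans h2.symm
  have hsub : Measurable fun z : E × E => z.1 - z.2 := measurable_fst.sub measurable_snd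
  have hYind : iIndepFun (fun i (x : ι → E × E) => (x i).1 - (x i).2)
      (Measure.pi fun i => (ν i).prod (ν i)) :=
    iIndepFun_pi (X := fun i (z : E × E) => z.1 - z.2) fun i => hsub.aemeasurable
  have hYm : ∀ i, Measurable fun x : ι → E × E => (x i).1 - (x i).2 := fun i =>
    hsub.comp (measurable_pi_apply i)
  have hYsymm : ∀ i, IsSymmetricRandom (Measure.pi fun i => (ν i).prod (ν i))
      (fun x : ι → E × E => (x i).1 - (x i).2) := by
    intro i
    refine ⟨(hYm i).neg.aemeasurable, (hYm i).aemeasurable, ?_⟩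
    have hev := measurePreserving_eval (fun i => (ν i).prod (ν i)) i
    have e1 : (fun x : ι → E × E => -((x i).1 - (x i).2)) =
        (fun z : E × E => z.1 - z.2) ∘ Prod.swap ∘ Function.eval i := by
      ext x; simp
    have e2 : (fun x : ι → E × E => (x i).1 - (x i).2) =
        (fun z : E × E => z.1 - z.2) ∘ Function.eval i := rfl
    rw [e1, e2, ← Measure.map_map hsub (measurable_swap.comp (measurable_pi_apply i)),
      ← Measure.map_map measurable_swap (measurable_pi_apply i), hev.map_eq, Measure.prod_swap,
      ← Measure.map_map hsub (measurable_pi_apply i), hev.map_eq]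
  have hfs : Measurable fun x : ι → E => f (∑ i, x i) :=
    hf.comp (Finset.measurable_fun_sum _ fun i _ => measurable_pi_apply i)
  rw [htrans _ hfs, htrans (fun x => f (signedSum x ε)) (hf.comp (measurable_signedSum ε))]
  exact (lintegral_signedSum_eq_of_symmetric hYm hYind hYsymm hf ε).symm

omit [MeasurableSpace E] [BorelSpace E] [SecondCountableTopology E] in
-- Jensen's inequality, obtained from monotonicity of `L^p` norms on a probability space.
theorem enorm_sub_integral_rpow_le [NormedSpace ℝ E] [CompleteSpace E] {S : Ω → E}
    (hS : Integrable S μ) (c : E) {q : ℝ} (hq : 1 ≤ q) :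
    ‖c - ∫ ω, S ω ∂μ‖ₑ ^ q ≤ ∫⁻ ω, ‖c - S ω‖ₑ ^ q ∂μ := by
  have hint : Integrable (fun ω => c - S ω) μ := (integrable_const c).sub hS
  have h1 : c - ∫ ω, S ω ∂μ = ∫ ω, (c - S ω) ∂μ := by
    rw [integral_sub (integrable_const c) hS]; simp
  have hq0 : 0 < q := by linarith
  have h2 := eLpNorm_le_eLpNorm_of_exponent_le (μ := μ) (p := 1) (q := ENNReal.ofReal q)
    (f := fun ω => c - S ω) (by simpa using ENNReal.ofReal_le_ofReal hq) hint.1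
  rw [eLpNorm_one_eq_lintegral_enorm, eLpNorm_eq_lintegral_rpow_enorm_toReal (by simpa using hq0)
    ENNReal.ofReal_ne_top, ENNReal.toReal_ofReal hq0.le] at h2
  rw [h1, ← ENNReal.le_rpow_inv_iff hq0, ← one_div]
  exact (enorm_integral_le_lintegral_enorm _).trans h2

omit [DecidableEq ι] in
-- The mean is replaced by an independent copy via Jensen. The signs are then inserted, and
-- Minkowski separates the two copies, whence the factor `2 ^ q`. The bound holds for every fixed
-- sign pattern.
theorem lintegral_sub_integral_rpow_le [NormedSpace ℝ E] [CompleteSpace E] {W : ι → Ω → E}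
    (hW : ∀ i, Measurable (W i)) (hind : iIndepFun W μ) (hint : ∀ i, Integrable (W i) μ)
    {q : ℝ} (hq : 1 ≤ q) (ε : ι → ℤˣ) :
    ∫⁻ ω, ‖∑ i, W i ω - ∑ i, ∫ ω, W i ω ∂μ‖ₑ ^ q ∂μ ≤
      2 ^ q * ∫⁻ ω, ‖signedSum (fun i => W i ω) ε‖ₑ ^ q ∂μ := by
  have hq0 : 0 < q := by linarith
  have hWm : Measurable fun ω i => W i ω := measurable_pi_lambda _ hW
  have hX : Measurable fun ω => ‖signedSum (fun i => W i ω) ε‖ₑ :=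
    ((measurable_signedSum ε).comp hWm).enorm
  have hSm : Measurable fun ω => ∑ i, W i ω := Finset.measurable_fun_sum _ fun i _ => hW i
  have hf : Measurable fun x : E => ‖x‖ₑ ^ q := measurable_enorm.pow_const q
  set I := ∫⁻ ω, ‖signedSum (fun i => W i ω) ε‖ₑ ^ q ∂μ with hI
  have h1 : ∫⁻ ω, ‖∑ i, W i ω - ∑ i, ∫ ω, W i ω ∂μ‖ₑ ^ q ∂μ ≤
      ∫⁻ z, ‖∑ i, (W i z.1 - W i z.2)‖ₑ ^ q ∂(μ.prod μ) := by
    have hm : Measurable fun z : Ω × Ω => ‖∑ i, (W i z.1 - W i z.2)‖ₑ ^ q := by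
      refine hf.comp (Finset.measurable_fun_sum _ fun i _ => ?_)
      exact ((hW i).comp measurable_fst).sub ((hW i).comp measurable_snd)
    rw [lintegral_prod _ hm.aemeasurable, ← integral_finsetSum _ fun i _ => hint i]
    refine lintegral_mono fun ω => ?_
    simp only [Finset.sum_sub_distrib]
    exact enorm_sub_integral_rpow_le (integrable_finsetSum _ fun i _ => hint i) _ hq
  refine h1.trans ?_
  rw [lintegral_prod_sub_eq_signedSum hW hind hf ε]
  have hmink := ENNReal.lintegral_Lp_add_le (μ := μ.prod μ) (p := q)
    (f := fun z => ‖signedSum (fun i => W i z.1) ε‖ₑ)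
    (g := fun z => ‖signedSum (fun i => W i z.2) ε‖ₑ)
    (hX.comp measurable_fst).aemeasurable (hX.comp measurable_snd).aemeasurable hq
  have hfst : ∫⁻ z, ‖signedSum (fun i => W i z.1) ε‖ₑ ^ q ∂(μ.prod μ) = I :=
    (measurePreserving_fst (μ := μ) (ν := μ)).lintegral_comp (hX.pow_const q)
  have hsnd : ∫⁻ z, ‖signedSum (fun i => W i z.2) ε‖ₑ ^ q ∂(μ.prod μ) = I :=
    (measurePreserving_snd (μ := μ) (ν := μ)).lintegral_comp (hX.pow_const q)
  rw [hfst, hsnd, ← two_mul, one_div, ENNReal.rpow_inv_le_iff hq0,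
    ENNReal.mul_rpow_of_nonneg _ _ hq0.le, ENNReal.rpow_inv_rpow hq0.ne'] at hmink
  refine le_trans (lintegral_mono fun z => ?_) hmink
  refine ENNReal.rpow_le_rpow ?_ hq0.le
  have : signedSum (fun i => W i z.1 - W i z.2) ε =
      signedSum (fun i => W i z.1) ε - signedSum (fun i => W i z.2) ε := by
    simp [signedSum, smul_sub]
  rw [this]
  exact enorm_sub_le

end Symmetrization

/-! ### Pointwise bounds in `[0, ∞]` and the quadratic inequality -/

section MatrixMoments

variable {n : Type*} [Fintype n] [DecidableEq n] {ι : Type*} [Fintype ι] [DecidableEq ι]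

theorem sum_signs_enorm_rpow_le [Nonempty n] {A : ι → Matrix n n ℝ} (hA : ∀ i, (A i).IsHermitian)
    {q r : ℝ} (hq : 0 < q) (hqr : q ≤ r) (hr : 2 ≤ r) (hn : 2 * Real.log (Fintype.card n) ≤ r) :
    ∑ ε : ι → ℤˣ, ‖signedSum A ε‖ₑ ^ q ≤
      Fintype.card (ι → ℤˣ) * (ENNReal.ofReal (Real.exp 1 * r) * ‖∑ i, A i ^ 2‖ₑ) ^ (q / 2) := by
  have h := ENNReal.ofReal_le_ofReal (sum_signs_norm_rpow_le hA hq hqr hr hn)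
  have her : 0 ≤ Real.exp 1 * r := by positivity
  rw [ENNReal.ofReal_sum_of_nonneg fun ε _ => Real.rpow_nonneg (norm_nonneg _) _,
    ENNReal.ofReal_mul (by positivity), ENNReal.ofReal_natCast,
    ← ENNReal.ofReal_rpow_of_nonneg (mul_nonneg her (norm_nonneg _)) (by positivity),
    ENNReal.ofReal_mul her, ofReal_norm] at h
  refine le_trans (le_of_eq ?_) h
  refine Finset.sum_congr rfl fun ε _ => ?_
  rw [← ENNReal.ofReal_rpow_of_nonneg (norm_nonneg _) hq.le, ofReal_norm]

omit [DecidableEq ι] in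
theorem enorm_sum_sq_le_of_posSemidef [Nonempty n] (W : ι → Matrix n n ℝ)
    (hW : ∀ i, (W i).PosSemidef) :
    ‖∑ i, W i ^ 2‖ₑ ≤ (⨆ i, ‖W i‖ₑ) * ‖∑ i, W i‖ₑ := by
  have hfin : (⨆ i, ‖W i‖ₑ) ≠ ∞ := by
    rcases isEmpty_or_nonempty ι with h | h
    · simp
    · obtain ⟨i, hi⟩ := exists_eq_ciSup_of_finite (f := fun i => ‖W i‖ₑ)
      rw [← hi]
      exact enorm_ne_top
  have h := norm_sum_sq_le_of_posSemidef W hW (M := (⨆ i, ‖W i‖ₑ).toReal) ENNReal.toReal_nonneg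
    fun i => by
      rw [← toReal_enorm]
      exact ENNReal.toReal_mono hfin (le_iSup (fun i => ‖W i‖ₑ) i)
  have h2 := ENNReal.ofReal_le_ofReal h
  rwa [ENNReal.ofReal_mul ENNReal.toReal_nonneg, ENNReal.ofReal_toReal hfin,
    ofReal_norm, ofReal_norm] at h2

/-- If `√x > √a + b`, then `a ≤ √x * √a`, so `x ≤ √x * (√a + b)`. Cancelling `√x` is a
contradiction, and this needs `x` finite. -/
theorem le_sq_of_le_add_mul_sqrt {x a b : ℝ≥0∞} (hx : x ≠ ∞)
    (h : x ≤ a + b * x ^ (1 / 2 : ℝ)) : x ≤ (a ^ (1 / 2 : ℝ) + b) ^ 2 := by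
  have hsq : ∀ c : ℝ≥0∞, c ^ (1 / 2 : ℝ) * c ^ (1 / 2 : ℝ) = c := fun c => by
    rw [← ENNReal.rpow_add_of_nonneg _ _ (by norm_num) (by norm_num)]; norm_num
  set y := x ^ (1 / 2 : ℝ) with hy
  suffices y ≤ a ^ (1 / 2 : ℝ) + b by
    rw [← hsq x, pow_two]
    exact mul_le_mul' this this
  by_contra! hlt
  have hy0 : y ≠ 0 := (pos_of_gt hlt).ne'
  have hyt : y ≠ ∞ := ENNReal.rpow_ne_top_of_nonneg (by norm_num) hx
  have hle : y * y ≤ y * (a ^ (1 / 2 : ℝ) + b) := by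
    rw [hsq x]
    refine h.trans ?_
    rw [mul_add, mul_comm b]
    gcongr
    calc a = a ^ (1 / 2 : ℝ) * a ^ (1 / 2 : ℝ) := (hsq a).symm
      _ ≤ _ := mul_le_mul_left (le_self_add.trans hlt.le) _
  exact absurd ((ENNReal.mul_le_mul_iff_right hy0 hyt).1 hle) (not_le.2 hlt)

end MatrixMoments

/-! ### Moments of sums of independent random matrices -/

section RandomMatrices

variable {Ω : Type*} [MeasurableSpace Ω] {μ : Measure Ω}
  {n : Type*} [Fintype n] [DecidableEq n] {ι : Type*} [Fintype ι]

theorem integral_posSemidef {W : Ω → Matrix n n ℝ} (hW : ∀ᵐ ω ∂μ, (W ω).PosSemidef) :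
    (∫ ω, W ω ∂μ).PosSemidef := by
  -- Without integrability the integral is `0` by convention, which is still positive semidefinite.
  by_cases hint : Integrable W μ
  swap
  · rw [integral_undef hint]
    exact Matrix.PosSemidef.zero
  refine Matrix.PosSemidef.of_dotProduct_mulVec_nonneg ?_ fun x => ?_
  · let T : Matrix n n ℝ →L[ℝ] Matrix n n ℝ :=
      LinearMap.toContinuousLinearMap (Matrix.transposeLinearEquiv n n ℝ ℝ).toLinearMap
    have h1 : ∫ ω, T (W ω) ∂μ = T (∫ ω, W ω ∂μ) := T.integral_comp_comm hint
    have h2 : ∫ ω, T (W ω) ∂μ = ∫ ω, W ω ∂μ :=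
      integral_congr_ae (hW.mono fun ω hω => hω.1)
    exact h1.symm.trans h2
  · let T : Matrix n n ℝ →L[ℝ] ℝ := LinearMap.toContinuousLinearMap
      { toFun := fun A => x ⬝ᵥ A.mulVec x
        map_add' := fun A B => by rw [Matrix.add_mulVec, dotProduct_add]
        map_smul' := fun c A => by rw [Matrix.smul_mulVec, dotProduct_smul]; rfl }
    have h1 : ∫ ω, T (W ω) ∂μ = T (∫ ω, W ω ∂μ) := T.integral_comp_comm hint
    have h2 : 0 ≤ ∫ ω, T (W ω) ∂μ :=
      integral_nonneg_of_ae (hW.mono fun ω hω => hω.dotProduct_mulVec_nonneg x)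
    rw [h1] at h2
    exact h2

theorem Matrix.l2_opENorm_mul_le (A B : Matrix n n ℝ) : ‖A * B‖ₑ ≤ ‖A‖ₑ * ‖B‖ₑ := by
  simp only [enorm_eq_nnnorm, ← ENNReal.coe_mul, ENNReal.coe_le_coe]
  exact nnnorm_mul_le A B

theorem Matrix.PosSemidef.enorm_rpow_half_le {A : Matrix n n ℝ} (hA : A.PosSemidef) :
    ‖A‖ₑ ^ (1 / 2 : ℝ) ≤ ‖CFC.sqrt A‖ₑ := by
  have h0 : CFC.sqrt A * CFC.sqrt A = A :=
    CFC.sqrt_mul_sqrt_self A (Matrix.nonneg_iff_posSemidef.mpr hA)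
  have h1 : ‖A‖ₑ ≤ ‖CFC.sqrt A‖ₑ ^ (2 : ℝ) := by
    rw [ENNReal.rpow_two, pow_two]
    calc ‖A‖ₑ = ‖CFC.sqrt A * CFC.sqrt A‖ₑ := by rw [h0]
      _ ≤ _ := Matrix.l2_opENorm_mul_le _ _
  rw [one_div]
  exact (ENNReal.rpow_inv_le_iff (by norm_num)).2 h1

variable [DecidableEq ι]

theorem sum_signs_lintegral_rpow_le [Nonempty n] {A : ι → Ω → Matrix n n ℝ}
    (hA : ∀ i, Measurable (A i)) (hH : ∀ i, ∀ᵐ ω ∂μ, (A i ω).IsHermitian)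
    {q r : ℝ} (hq : 0 < q) (hqr : q ≤ r) (hr : 2 ≤ r) (hn : 2 * Real.log (Fintype.card n) ≤ r) :
    ∑ ε : ι → ℤˣ, ∫⁻ ω, ‖signedSum (fun i => A i ω) ε‖ₑ ^ q ∂μ ≤
      Fintype.card (ι → ℤˣ) * (ENNReal.ofReal (Real.exp 1 * r) ^ (q / 2) *
        ∫⁻ ω, ‖∑ i, A i ω ^ 2‖ₑ ^ (q / 2) ∂μ) := by
  have hAm : Measurable fun ω i => A i ω := measurable_pi_lambda _ hA
  have hm : ∀ ε : ι → ℤˣ, Measurable fun ω => ‖signedSum (fun i => A i ω) ε‖ₑ ^ q := fun ε =>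
    ((measurable_signedSum ε).comp hAm).enorm.pow_const q
  have hsq : Measurable fun ω => ‖∑ i, A i ω ^ 2‖ₑ ^ (q / 2) :=
    (Finset.measurable_fun_sum _ fun i _ => (hA i).pow_const 2).enorm.pow_const _
  rw [← lintegral_finsetSum _ fun ε _ => hm ε, ← lintegral_const_mul _ hsq,
    ← lintegral_const_mul _ (hsq.const_mul _)]
  refine lintegral_mono_ae ?_
  filter_upwards [ae_all_iff.2 hH] with ω hω
  have h := sum_signs_enorm_rpow_le hω hq hqr hr hn
  rwa [ENNReal.mul_rpow_of_nonneg _ _ (by positivity)] at h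

variable [IsProbabilityMeasure μ]

omit [DecidableEq ι] in
theorem measurable_iSup_enorm {E : Type*} [NormedAddCommGroup E] [MeasurableSpace E]
    [OpensMeasurableSpace E] {W : ι → Ω → E} (hW : ∀ i, Measurable (W i)) :
    Measurable fun ω => ⨆ i, ‖W i ω‖ₑ :=
  Measurable.iSup fun i => (hW i).enorm

omit [Fintype ι] [DecidableEq ι] [IsProbabilityMeasure μ] in
theorem memLp_of_lintegral_iSup_ne_top {W : ι → Ω → Matrix n n ℝ} (hW : ∀ i, Measurable (W i))
    {q : ℝ} (hq : 0 < q) (hfin : ∫⁻ ω, (⨆ i, ‖W i ω‖ₑ) ^ q ∂μ ≠ ∞) (i : ι) :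
    MemLp (W i) (ENNReal.ofReal q) μ := by
  refine ⟨(hW i).aestronglyMeasurable, ?_⟩
  rw [eLpNorm_eq_lintegral_rpow_enorm_toReal (by simpa using hq) ENNReal.ofReal_ne_top,
    ENNReal.toReal_ofReal hq.le]
  refine ENNReal.rpow_lt_top_of_nonneg (by positivity) (ne_top_of_le_ne_top hfin ?_)
  exact lintegral_mono fun ω => ENNReal.rpow_le_rpow (le_iSup (fun i => ‖W i ω‖ₑ) i) hq.le

theorem lintegral_sum_posSemidef_le [Nonempty n] {q r : ℝ} (hq : 1 ≤ q) (hqr : q ≤ r) (hr : 2 ≤ r)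
    (hn : 2 * Real.log (Fintype.card n) ≤ r) {W : ι → Ω → Matrix n n ℝ}
    (hW : ∀ i, Measurable (W i)) (hind : iIndepFun W μ)
    (hpsd : ∀ i, ∀ᵐ ω ∂μ, (W i ω).PosSemidef) :
    (∫⁻ ω, ‖∑ i, W i ω‖ₑ ^ q ∂μ) ^ (1 / q) ≤
      (‖∑ i, ∫ ω, W i ω ∂μ‖ₑ ^ (1 / 2 : ℝ)
        + ENNReal.ofReal (2 * √(Real.exp 1 * r))
          * (∫⁻ ω, (⨆ i, ‖W i ω‖ₑ) ^ q ∂μ) ^ (1 / (2 * q))) ^ 2 := by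
  have hq0 : 0 < q := by linarith
  have her : 0 < Real.exp 1 * r := by positivity
  by_cases hfin : ∫⁻ ω, (⨆ i, ‖W i ω‖ₑ) ^ q ∂μ = ∞
  · have h2 : ENNReal.ofReal (2 * √(Real.exp 1 * r)) ≠ 0 := by
      rw [Ne, ENNReal.ofReal_eq_zero, not_le]; positivity
    rw [hfin, ENNReal.top_rpow_of_pos (by positivity), ENNReal.mul_top h2]
    simp
  have hmem := memLp_of_lintegral_iSup_ne_top hW hq0 hfin
  have h1q : 1 ≤ ENNReal.ofReal q := by simpa using ENNReal.ofReal_le_ofReal hq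
  have hint : ∀ i, Integrable (W i) μ := fun i => (hmem i).integrable h1q
  have hSm : Measurable fun ω => ∑ i, W i ω := Finset.measurable_fun_sum _ fun i _ => hW i
  have hMm := measurable_iSup_enorm hW
  -- Finiteness is what allows the moment to be absorbed in the quadratic inequality.
  have hx : (∫⁻ ω, ‖∑ i, W i ω‖ₑ ^ q ∂μ) ^ (1 / q) ≠ ∞ := by
    have := (memLp_finsetSum Finset.univ fun i _ => hmem i).2
    rw [eLpNorm_eq_lintegral_rpow_enorm_toReal (by simpa using hq0) ENNReal.ofReal_ne_top,
      ENNReal.toReal_ofReal hq0.le] at this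
    simpa using this.ne
  refine le_sq_of_le_add_mul_sqrt hx ?_
  set I := ∫⁻ ω, ‖∑ i, W i ω‖ₑ ^ q ∂μ with hI
  set J := ∫⁻ ω, (⨆ i, ‖W i ω‖ₑ) ^ q ∂μ with hJ
  set c := ENNReal.ofReal (Real.exp 1 * r) with hc
  set L := ∫⁻ ω, ‖∑ i, W i ω - ∑ i, ∫ ω, W i ω ∂μ‖ₑ ^ q ∂μ with hL
  have htri : I ^ (1 / q) ≤ L ^ (1 / q) + ‖∑ i, ∫ ω, W i ω ∂μ‖ₑ := by
    have hmink := ENNReal.lintegral_Lp_add_le (μ := μ) (p := q)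
      (f := fun ω => ‖∑ i, W i ω - ∑ i, ∫ ω, W i ω ∂μ‖ₑ)
      (g := fun _ => ‖∑ i, ∫ ω, W i ω ∂μ‖ₑ)
      (hSm.sub_const _).enorm.aemeasurable aemeasurable_const hq
    rw [lintegral_const, measure_univ, mul_one, one_div, ENNReal.rpow_rpow_inv hq0.ne',
      ← one_div] at hmink
    refine le_trans (ENNReal.rpow_le_rpow (lintegral_mono fun ω => ?_) (by positivity)) hmink
    refine ENNReal.rpow_le_rpow ?_ hq0.le
    calc ‖∑ i, W i ω‖ₑ = ‖(∑ i, W i ω - ∑ i, ∫ ω, W i ω ∂μ) + ∑ i, ∫ ω, W i ω ∂μ‖ₑ := by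
          rw [sub_add_cancel]
      _ ≤ _ := enorm_add_le _ _
  have hCS : ∫⁻ ω, ‖∑ i, W i ω ^ 2‖ₑ ^ (q / 2) ∂μ ≤ J ^ (1 / 2 : ℝ) * I ^ (1 / 2 : ℝ) := by
    have hh := ENNReal.lintegral_mul_le_Lp_mul_Lq μ Real.HolderConjugate.two_two
      (f := fun ω => (⨆ i, ‖W i ω‖ₑ) ^ (q / 2)) (g := fun ω => ‖∑ i, W i ω‖ₑ ^ (q / 2))
      (hMm.pow_const _).aemeasurable (hSm.enorm.pow_const _).aemeasurable
    simp only [← ENNReal.rpow_mul, div_mul_cancel₀ q (two_ne_zero' ℝ)] at hh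
    refine le_trans (lintegral_mono_ae ?_) hh
    filter_upwards [ae_all_iff.2 hpsd] with ω hω
    rw [Pi.mul_apply, ← ENNReal.mul_rpow_of_nonneg _ _ (by positivity)]
    exact ENNReal.rpow_le_rpow (enorm_sum_sq_le_of_posSemidef _ hω) (by positivity)
  -- Averaging the symmetrized bound over all sign patterns brings in Khintchine. To avoid division,
  -- both sides are multiplied by the number of patterns.
  have hLle : L ≤ 2 ^ q * (c ^ (q / 2) * (J ^ (1 / 2 : ℝ) * I ^ (1 / 2 : ℝ))) := by
    have hN0 : (Fintype.card (ι → ℤˣ) : ℝ≥0∞) ≠ 0 := by simp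
    have hNt : (Fintype.card (ι → ℤˣ) : ℝ≥0∞) ≠ ∞ := ENNReal.natCast_ne_top _
    rw [← ENNReal.mul_le_mul_iff_right hN0 hNt]
    calc (Fintype.card (ι → ℤˣ) : ℝ≥0∞) * L = ∑ ε : ι → ℤˣ, L := by simp
      _ ≤ ∑ ε : ι → ℤˣ, 2 ^ q * ∫⁻ ω, ‖signedSum (fun i => W i ω) ε‖ₑ ^ q ∂μ :=
          Finset.sum_le_sum fun ε _ => lintegral_sub_integral_rpow_le hW hind hint hq ε
      _ ≤ 2 ^ q * (Fintype.card (ι → ℤˣ) * (c ^ (q / 2) *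
            ∫⁻ ω, ‖∑ i, W i ω ^ 2‖ₑ ^ (q / 2) ∂μ)) := by
          rw [← Finset.mul_sum]
          gcongr
          exact sum_signs_lintegral_rpow_le hW
            (fun i => (hpsd i).mono fun ω hω => hω.1) hq0 hqr hr hn
      _ ≤ 2 ^ q * (Fintype.card (ι → ℤˣ) * (c ^ (q / 2) *
            (J ^ (1 / 2 : ℝ) * I ^ (1 / 2 : ℝ)))) := by gcongr
      _ = _ := by ring
  rw [add_comm] at htri
  refine htri.trans (add_le_add_right ?_ _)
  calc L ^ (1 / q) ≤ (2 ^ q * (c ^ (q / 2) * (J ^ (1 / 2 : ℝ) * I ^ (1 / 2 : ℝ)))) ^ (1 / q) :=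
        ENNReal.rpow_le_rpow hLle (by positivity)
    _ = 2 * (c ^ (1 / 2 : ℝ) * (J ^ (1 / (2 * q)) * (I ^ (1 / q)) ^ (1 / 2 : ℝ))) := by
        have hq1 : 0 ≤ 1 / q := by positivity
        simp only [ENNReal.mul_rpow_of_nonneg _ _ hq1, ← ENNReal.rpow_mul]
        have e1 : q * (1 / q) = 1 := by field_simp
        have e2 : q / 2 * (1 / q) = 1 / 2 := by field_simp
        have e3 : 1 / 2 * (1 / q) = 1 / (2 * q) := by field_simp
        have e4 : 1 / q * (1 / 2) = 1 / (2 * q) := by field_simp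
        rw [e1, e2, e3, e4, ENNReal.rpow_one]
    _ = _ := by
        rw [hc, ENNReal.ofReal_rpow_of_pos her, ← Real.sqrt_eq_rpow,
          ENNReal.ofReal_mul (by norm_num)]
        simp only [ENNReal.ofReal_ofNat]
        ring

theorem lintegral_sum_symmetric_le [Nonempty n] {q r : ℝ} (hq : 2 ≤ q) (hqr : q ≤ r)
    (hn : 2 * Real.log (Fintype.card n) ≤ r) {Y : ι → Ω → Matrix n n ℝ}
    (hY : ∀ i, Measurable (Y i)) (hind : iIndepFun Y μ)
    (hsymm : ∀ i, IsSymmetricRandom μ (Y i))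
    (hH : ∀ i, ∀ᵐ ω ∂μ, (Y i ω).IsHermitian) :
    (∫⁻ ω, ‖∑ i, Y i ω‖ₑ ^ q ∂μ) ^ (1 / q) ≤
      ENNReal.ofReal (√(Real.exp 1 * r)) * ‖CFC.sqrt (∑ i, ∫ ω, Y i ω ^ 2 ∂μ)‖ₑ
        + ENNReal.ofReal (2 * Real.exp 1 * r)
          * (∫⁻ ω, (⨆ i, ‖Y i ω‖ₑ) ^ q ∂μ) ^ (1 / q) := by
  have hq0 : 0 < q := by linarith
  have hr : 2 ≤ r := hq.trans hqr
  have her : 0 < Real.exp 1 * r := by positivity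
  have hpsd : ∀ i, ∀ᵐ ω ∂μ, (Y i ω ^ 2).PosSemidef := fun i => (hH i).mono fun ω hω => by
    have := Matrix.posSemidef_conjTranspose_mul_self (Y i ω)
    rwa [hω.eq, ← pow_two] at this
  set c := ENNReal.ofReal (Real.exp 1 * r) with hc
  set K := ∫⁻ ω, ‖∑ i, Y i ω ^ 2‖ₑ ^ (q / 2) ∂μ with hK
  have hKh : ∫⁻ ω, ‖∑ i, Y i ω‖ₑ ^ q ∂μ ≤ c ^ (q / 2) * K := by
    have hN0 : (Fintype.card (ι → ℤˣ) : ℝ≥0∞) ≠ 0 := by simp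
    have hNt : (Fintype.card (ι → ℤˣ) : ℝ≥0∞) ≠ ∞ := ENNReal.natCast_ne_top _
    rw [← ENNReal.mul_le_mul_iff_right hN0 hNt]
    refine le_trans (le_of_eq ?_) (sum_signs_lintegral_rpow_le hY hH hq0 hqr hr hn)
    have hf : Measurable fun x : Matrix n n ℝ => ‖x‖ₑ ^ q := measurable_enorm.pow_const q
    have h := fun ε : ι → ℤˣ => lintegral_signedSum_eq_of_symmetric hY hind hsymm hf ε
    rw [Finset.sum_congr rfl fun ε _ => h ε]
    simp
  -- The hypothesis `2 ≤ q` makes the exponent `q / 2` admissible here.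
  have hsq := lintegral_sum_posSemidef_le (q := q / 2) (r := r) (by linarith) (by linarith) hr hn
    (W := fun i ω => Y i ω ^ 2) (fun i => (hY i).pow_const 2)
    (hind.comp (fun _ A => A ^ 2) fun _ => measurable_id.pow_const 2) hpsd
  have hmax : ∫⁻ ω, (⨆ i, ‖Y i ω ^ 2‖ₑ) ^ (q / 2) ∂μ ≤ ∫⁻ ω, (⨆ i, ‖Y i ω‖ₑ) ^ q ∂μ := by
    refine lintegral_mono fun ω => ?_
    calc (⨆ i, ‖Y i ω ^ 2‖ₑ) ^ (q / 2) ≤ ((⨆ i, ‖Y i ω‖ₑ) ^ (2 : ℝ)) ^ (q / 2) := by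
          refine ENNReal.rpow_le_rpow (iSup_le fun i => ?_) (by positivity)
          rw [ENNReal.rpow_two, pow_two, pow_two]
          have := le_iSup (fun i => ‖Y i ω‖ₑ) i
          exact (Matrix.l2_opENorm_mul_le _ _).trans (mul_le_mul' this this)
      _ = _ := by rw [← ENNReal.rpow_mul, mul_div_cancel₀ q two_ne_zero]
  have hsqrt : K ^ (1 / q) ≤ ‖CFC.sqrt (∑ i, ∫ ω, Y i ω ^ 2 ∂μ)‖ₑ +
      ENNReal.ofReal (2 * √(Real.exp 1 * r)) *
        (∫⁻ ω, (⨆ i, ‖Y i ω‖ₑ) ^ q ∂μ) ^ (1 / q) := by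
    have h2 := ENNReal.rpow_le_rpow hsq (z := 2⁻¹) (by norm_num)
    rw [← ENNReal.rpow_mul, ← ENNReal.rpow_two, ENNReal.rpow_rpow_inv two_ne_zero,
      show 1 / (q / 2) * 2⁻¹ = 1 / q by field_simp, mul_div_cancel₀ q two_ne_zero] at h2
    refine h2.trans (add_le_add ?_ ?_)
    · exact (Matrix.posSemidef_sum _ fun i _ => integral_posSemidef (hpsd i)).enorm_rpow_half_le
    · gcongr
  have hc2 : ENNReal.ofReal (√(Real.exp 1 * r)) = c ^ (1 / 2 : ℝ) := by
    rw [hc, ENNReal.ofReal_rpow_of_pos her, ← Real.sqrt_eq_rpow]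
  have hc3 : ENNReal.ofReal (2 * Real.exp 1 * r) =
      c ^ (1 / 2 : ℝ) * ENNReal.ofReal (2 * √(Real.exp 1 * r)) := by
    rw [← hc2, ← ENNReal.ofReal_mul (Real.sqrt_nonneg _)]
    congr 1
    nlinarith [Real.mul_self_sqrt her.le]
  calc (∫⁻ ω, ‖∑ i, Y i ω‖ₑ ^ q ∂μ) ^ (1 / q) ≤ (c ^ (q / 2) * K) ^ (1 / q) :=
        ENNReal.rpow_le_rpow hKh (by positivity)
    _ = c ^ (1 / 2 : ℝ) * K ^ (1 / q) := by
        rw [ENNReal.mul_rpow_of_nonneg _ _ (by positivity), ← ENNReal.rpow_mul,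
          show q / 2 * (1 / q) = 1 / 2 by field_simp]
    _ ≤ _ := mul_le_mul_right hsqrt _
    _ = _ := by rw [mul_add, ← mul_assoc, hc2, hc3]

end RandomMatrices

/-- The convention that a nonintegrable matrix has integral `0` is harmless: whenever it applies,
the maximum term on the right is already infinite. -/
theorem mainTheorem3 {Ω : Type*} [MeasurableSpace Ω] (μ : Measure Ω) [IsProbabilityMeasure μ]
    {ι : Type*} [Fintype ι] (p : ℕ) (hp : 3 ≤ p) :
    -- sums of independent random positive-semidefinite matrices
    (∀ q r : ℝ, 1 ≤ q → max q (2 * Real.log p) ≤ r →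
      ∀ W : ι → Ω → Matrix (Fin p) (Fin p) ℝ,
        (∀ i, Measurable (W i)) → iIndepFun W μ →
        (∀ i, ∀ᵐ ω ∂μ, (W i ω).PosSemidef) →
        (∫⁻ ω, ‖∑ i, W i ω‖ₑ ^ q ∂μ) ^ (1 / q) ≤
          (‖∑ i, ∫ ω, W i ω ∂μ‖ₑ ^ (1 / 2 : ℝ)
            + ENNReal.ofReal (2 * √(Real.exp 1 * r))
              * (∫⁻ ω, (⨆ i, ‖W i ω‖ₑ) ^ q ∂μ) ^ (1 / (2 * q))) ^ 2) ∧
    -- sums of independent, symmetric random self-adjoint matrices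
    (∀ q r : ℝ, 2 ≤ q → max q (2 * Real.log p) ≤ r →
      ∀ Y : ι → Ω → Matrix (Fin p) (Fin p) ℝ,
        (∀ i, Measurable (Y i)) → iIndepFun Y μ →
        (∀ i, IsSymmetricRandom μ (Y i)) →
        (∀ i, ∀ᵐ ω ∂μ, (Y i ω).IsHermitian) →
        (∫⁻ ω, ‖∑ i, Y i ω‖ₑ ^ q ∂μ) ^ (1 / q) ≤
          ENNReal.ofReal (√(Real.exp 1 * r))
              * ‖CFC.sqrt (∑ i, ∫ ω, Y i ω ^ 2 ∂μ)‖ₑ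
            + ENNReal.ofReal (2 * Real.exp 1 * r)
              * (∫⁻ ω, (⨆ i, ‖Y i ω‖ₑ) ^ q ∂μ) ^ (1 / q)) ∧
    -- the second-moment inequality
    (∀ Y : ι → Ω → Matrix (Fin p) (Fin p) ℝ,
        (∀ i, Measurable (Y i)) → iIndepFun Y μ →
        (∀ i, IsSymmetricRandom μ (Y i)) →
        (∀ i, ∀ᵐ ω ∂μ, (Y i ω).IsHermitian) →
        (∫⁻ ω, ‖∑ i, Y i ω‖ₑ ^ 2 ∂μ) ^ (1 / 2 : ℝ) ≤
          ENNReal.ofReal (√(2 * Real.exp 1 * Real.log p))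
              * ‖CFC.sqrt (∑ i, ∫ ω, Y i ω ^ 2 ∂μ)‖ₑ
            + ENNReal.ofReal (4 * Real.exp 1 * Real.log p)
              * (∫⁻ ω, (⨆ i, ‖Y i ω‖ₑ ^ 2) ∂μ) ^ (1 / 2 : ℝ)) := by
  classical
  have : Nonempty (Fin p) := ⟨⟨0, by omega⟩⟩
  -- Since `p ≥ 3 > e`, the choice `r = 2 * log p` satisfies `r ≥ 2`, as the case `q = 2` requires.
  have hlog : 1 ≤ Real.log p := by
    have hp' : (3 : ℝ) ≤ p := by exact_mod_cast hp
    rw [Real.le_log_iff_exp_le (by linarith)]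
    linarith [Real.exp_one_lt_three]
  refine ⟨fun q r hq hr W hW hind hpsd => ?_, fun q r hq hr Y hY hind hsymm hH => ?_,
    fun Y hY hind hsymm hH => ?_⟩
  · have h2 := (le_max_right _ _).trans hr
    exact lintegral_sum_posSemidef_le hq ((le_max_left _ _).trans hr) (by linarith)
      (by simpa using h2) hW hind hpsd
  · have h2 := (le_max_right _ _).trans hr
    exact lintegral_sum_symmetric_le hq ((le_max_left _ _).trans hr)
      (by simpa using h2) hY hind hsymm hH
  · have h := lintegral_sum_symmetric_le (q := 2) (r := 2 * Real.log p) le_rfl (by linarith)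
      (by simp) hY hind hsymm hH
    have hsup : ∀ ω, (⨆ i, ‖Y i ω‖ₑ) ^ 2 = ⨆ i, ‖Y i ω‖ₑ ^ 2 := fun ω => by
      have := (ENNReal.orderIsoRpow 2 two_pos).map_iSup fun i => ‖Y i ω‖ₑ
      simp only [ENNReal.orderIsoRpow_apply, ENNReal.rpow_two] at this
      exact this
    simp only [ENNReal.rpow_two, hsup] at h
    rwa [show Real.exp 1 * (2 * Real.log p) = 2 * Real.exp 1 * Real.log p by ring,
      show 2 * Real.exp 1 * (2 * Real.log p) = 4 * Real.exp 1 * Real.log p by ring] at h
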